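/- Throughout $i\in\{1,2\}$; $\mathsf{AtProp}_1,\mathsf{AtProp}_2$ are sets of atomic propositions. **Language.** Formulas $A_i$ and structures $X_i$ of type $\mathsf L_1$ and $\mathsf L_2$ are defined simultaneously by $$A_1 ::= p_1\mid 1_1\mid 0_1\mid \mathrm p A_2\mid A_1\sqcap_1 A_1\mid A_1\sqcup_1 A_1,\qquad A_2 ::= p_2\mid 1_2\mid 0_2\mid \mathrm n A_1\mid A_2\sqcap_2 A_2\mid A_2\sqcup_2 A_2,$$ $$X_1 ::= A_1\mid \hat 1_1\mid\check 0_1\mid \mathrm P X_2\mid X_1\hat\sqcap_1X_1\mid X_1\check\sqcup_1X_1\mid X_1\check\sqsupset_1X_1\mid X_1\hat\sqsubset_1X_1,$$ $$X_2 ::= A_2\mid \hat 1_2\mid\check 0_2\mid \mathrm N X_1\mid X_2\hat\sqcap_2X_2\mid X_2\check\sqcup_2X_2\mid X_2\check\sqsupset_2X_2\mid X_2\hat\sqsubset_2X_2,$$ with $p_i\in\mathsf{AtProp}_i$. For D.CBL one adds the connectives ${\sim}_iA_i$ (formulas of type $\mathsf L_i$) and $\ast_iX_i$ (structures of type $\mathsf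 L_i$). A sequent is $X_i\vdash Y_i$ with both sides of the same type. Below, $A,B$ are formulas and $X,Y,Z,W$ structures, of type $\mathsf L_i$ unless a subscript or an operator $\mathrm P,\mathrm N,\mathrm p,\mathrm n$ prescribes the type; "$S\,/\,T$" is the rule with premise(s) $S$ and conclusion $T$, and "$S\,/\!/\,T$" stands for both $S/T$ and $T/S$. **Rules of D.BL.** - Identity and cut: $p_i\vdash p_i$ (no premise); $\;X\vdash A,\ A\vdash Y\ /\ X\vdash Y$ (Cut). - Display: $X\hat\sqcap_iY\vdash Z\,/\!/\,X\vdash Y\check\sqsupset_iZ$; $\;X\vdash Y\check\sqcup_iZ\,/\!/\,X\hat\sqsubset_iY\vdash Z$; $\;\mathrm PX_2\vdash Y_1\,/\!/\,X_2\vdash\mathrm NY_1$; $\;\mathrm NX_1\vdash Y_2\,/\!/\,X_1\vdash\mathrm PY_2$. - Pure-type structural rules: $X\hat\sqcap_i\hat1_i\vdash Y/X\vdash Y$; $\;X\vdash Y\check\sqcup_i\check0_i/X\vdash Y$; $\;X\hat\sqcap_iY\vdash Z/Y\hat\sqcap_iX\vdash Z$; $\;X\vdash Y\check\sqcup_iZ/X\vdash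 Z\check\sqcup_iY$; $\;(X\hat\sqcap_iY)\hat\sqcap_iZ\vdash W/X\hat\sqcap_i(Y\hat\sqcap_iZ)\vdash W$; $\;X\vdash(Y\check\sqcup_iZ)\check\sqcup_iW/X\vdash Y\check\sqcup_i(Z\check\sqcup_iW)$; $\;X\vdash Z/X\hat\sqcap_iY\vdash Z$; $\;X\vdash Y/X\vdash Y\check\sqcup_iZ$; $\;X\hat\sqcap_iX\vdash Z/X\vdash Z$; $\;X\vdash Y\check\sqcup_iY/X\vdash Y$. - Pure-type operational rules: $\hat1_i\vdash X/1_i\vdash X$; $\;\hat1_i\vdash1_i$ and $0_i\vdash\check0_i$ (no premise); $\;X\vdash\check0_i/X\vdash0_i$; $\;A\hat\sqcap_iB\vdash X/A\sqcap_iB\vdash X$; $\;X\vdash A,\ Y\vdash B/X\hat\sqcap_iY\vdash A\sqcap_iB$; $\;A\vdash X,\ B\vdash Y/A\sqcup_iB\vdash X\check\sqcup_iY$; $\;X\vdash A\check\sqcup_iB/X\vdash A\sqcup_iB$. - Multi-type structural rules: $X_1\vdash Y_1\,/\!/\,\mathrm NX_1\vdash\mathrm NY_1$; $\;X_2\vdash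 Y_2\,/\!/\,\mathrm PX_2\vdash\mathrm PY_2$; $\;\check0_1\vdash X_1/\mathrm P\check0_2\vdash X_1$; $\;X_1\vdash\hat1_1/X_1\vdash\mathrm P\hat1_2$. - Multi-type operational rules: $\mathrm NA_1\vdash X_2/\mathrm nA_1\vdash X_2$; $\;X_2\vdash\mathrm NA_1/X_2\vdash\mathrm nA_1$; $\;\mathrm PA_2\vdash X_1/\mathrm pA_2\vdash X_1$; $\;X_1\vdash\mathrm PA_2/X_1\vdash\mathrm pA_2$. **Additional rules of D.CBL.** $\ast_iX\vdash Y\,/\!/\,\ast_iY\vdash X$; $\;X\vdash\ast_iY\,/\!/\,Y\vdash\ast_iX$; $\;X\vdash Y\,/\!/\,\ast_iY\vdash\ast_iX$; $\;\mathrm N\ast_1X_1\vdash Y_2/\ast_2\mathrm NX_1\vdash Y_2$; $\;X_2\vdash\mathrm N\ast_1Y_1/X_2\vdash\ast_2\mathrm NY_1$; $\;\ast_iA\vdash Y/{\sim}_iA\vdash Y$; $\;X\vdash\ast_iA/X\vdash{\sim}_iA$. **Theorem.** Let $\mathsf D$ be D.BL or D.CBL. 1. (Cut elimination) Every sequent that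 is derivable in $\mathsf D$ has a derivation in $\mathsf D$ in which Cut is not applied. 2. (Subformula property) In every cut-free derivation in $\mathsf D$ of a sequent $S$, each formula that occurs in some sequent of the derivation is a subformula (possibly of the other type) of a formula that occurs in $S$. Here the formulas occurring in a sequent are those from which its two structures are built by means of the structural operators. -/

import Mathlib

namespace BilatticeDisplay

/-- The two types `L₁` and `L₂` of the multi-type language. -/
inductive Ty where
  | one
  | two

/-- Which calculus is meant: `BL` selects D.BL (bilattice logic), `CBL` selects D.CBL
(bilattice logic with conflation). -/
inductive Logic where
  | BL
  | CBL

/-- Formulas of type `L₁` and `L₂` (simultaneously), over the sets `At .one` and `At .two` of atomic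
propositions. The connectives `∼₁`, `∼₂` (`neg`) are available in the language of D.CBL only. -/
inductive Fm (L : Logic) (At : Ty → Type*) : Ty → Type _ where
  | atom {i : Ty} (p : At i) : Fm L At i
  | one {i : Ty} : Fm L At i
  | zero {i : Ty} : Fm L At i
  | p (A : Fm L At .two) : Fm L At .one
  | n (A : Fm L At .one) : Fm L At .two
  | meet {i : Ty} (A B : Fm L At i) : Fm L At i
  | join {i : Ty} (A B : Fm L At i) : Fm L At i
  | neg {i : Ty} (h : L = .CBL) (A : Fm L At i) : Fm L At i

/-- Structures of type `L₁` and `L₂` (simultaneously). The structural operators are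
`one` (`1̂ᵢ`), `zero` (`0̌ᵢ`), `P`, `N`, `meet` (`⊓̂ᵢ`), `join` (`⊔̌ᵢ`), the residuals
`imp` (`⊐̌ᵢ`) and `excl` (`⊏̂ᵢ`) and, for D.CBL only, `star` (`∗ᵢ`). -/
inductive Str (L : Logic) (At : Ty → Type*) : Ty → Type _ where
  | fm {i : Ty} (A : Fm L At i) : Str L At i
  | one {i : Ty} : Str L At i
  | zero {i : Ty} : Str L At i
  | P (X : Str L At .two) : Str L At .one
  | N (X : Str L At .one) : Str L At .two
  | meet {i : Ty} (X Y : Str L At i) : Str L At i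
  | join {i : Ty} (X Y : Str L At i) : Str L At i
  | imp {i : Ty} (X Y : Str L At i) : Str L At i
  | excl {i : Ty} (X Y : Str L At i) : Str L At i
  | star {i : Ty} (h : L = .CBL) (X : Str L At i) : Str L At i

/-- A sequent `X ⊢ Y`: two structures of the same type. -/
structure Sequent (L : Logic) (At : Ty → Type*) where
  {ty : Ty}
  ant : Str L At ty
  suc : Str L At ty

infix:50 " ⊢ᴰ " => Sequent.mk

open Str in
/-- The rules without premises. -/
inductive ZeroaryRule {L : Logic} {At : Ty → Type*} : Sequent L At → Prop where
  | id {i : Ty} (p : At i) : ZeroaryRule (fm (.atom p) ⊢ᴰ fm (.atom p))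
  | one_right {i : Ty} : ZeroaryRule ((one : Str L At i) ⊢ᴰ fm .one)
  | zero_left {i : Ty} : ZeroaryRule (fm (.zero : Fm L At i) ⊢ᴰ zero)

open Str in
/-- The invertible (double line) rules: `DoubleLine s t` has `s` above and `t` below the line. -/
inductive DoubleLine {L : Logic} {At : Ty → Type*} : Sequent L At → Sequent L At → Prop where
  -- pure-type display rules
  | res_left {i : Ty} (X Y Z : Str L At i) :
      DoubleLine (meet X Y ⊢ᴰ Z) (X ⊢ᴰ imp Y Z)
  | res_right {i : Ty} (X Y Z : Str L At i) :
      DoubleLine (X ⊢ᴰ join Y Z) (excl X Y ⊢ᴰ Z)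
  -- multi-type display rules
  | adj_left (X : Str L At .two) (Y : Str L At .one) :
      DoubleLine (P X ⊢ᴰ Y) (X ⊢ᴰ N Y)
  | adj_right (X : Str L At .one) (Y : Str L At .two) :
      DoubleLine (N X ⊢ᴰ Y) (X ⊢ᴰ P Y)
  -- multi-type structural rules
  | N (X Y : Str L At .one) : DoubleLine (X ⊢ᴰ Y) (N X ⊢ᴰ N Y)
  | P (X Y : Str L At .two) : DoubleLine (X ⊢ᴰ Y) (P X ⊢ᴰ P Y)
  -- D.CBL only: display and structural rules for the structural operators `∗ᵢ`
  | adj_star_left {i : Ty} (h : L = .CBL) (X Y : Str L At i) :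
      DoubleLine (star h X ⊢ᴰ Y) (star h Y ⊢ᴰ X)
  | adj_star_right {i : Ty} (h : L = .CBL) (X Y : Str L At i) :
      DoubleLine (X ⊢ᴰ star h Y) (Y ⊢ᴰ star h X)
  | cont {i : Ty} (h : L = .CBL) (X Y : Str L At i) :
      DoubleLine (X ⊢ᴰ Y) (star h Y ⊢ᴰ star h X)

open Str in
/-- The rules with one premise: `UnaryRule s t` has premise `s` and conclusion `t`. -/
inductive UnaryRule {L : Logic} {At : Ty → Type*} : Sequent L At → Sequent L At → Prop where
  -- double line rules may be read in both directions
  | down {s t : Sequent L At} (h : DoubleLine s t) : UnaryRule s t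
  | up {s t : Sequent L At} (h : DoubleLine s t) : UnaryRule t s
  -- pure-type structural rules
  | one_str {i : Ty} (X Y : Str L At i) : UnaryRule (meet X one ⊢ᴰ Y) (X ⊢ᴰ Y)
  | zero_str {i : Ty} (X Y : Str L At i) : UnaryRule (X ⊢ᴰ join Y zero) (X ⊢ᴰ Y)
  | E_left {i : Ty} (X Y Z : Str L At i) : UnaryRule (meet X Y ⊢ᴰ Z) (meet Y X ⊢ᴰ Z)
  | E_right {i : Ty} (X Y Z : Str L At i) : UnaryRule (X ⊢ᴰ join Y Z) (X ⊢ᴰ join Z Y)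
  | A_left {i : Ty} (X Y Z W : Str L At i) :
      UnaryRule (meet (meet X Y) Z ⊢ᴰ W) (meet X (meet Y Z) ⊢ᴰ W)
  | A_right {i : Ty} (X Y Z W : Str L At i) :
      UnaryRule (X ⊢ᴰ join (join Y Z) W) (X ⊢ᴰ join Y (join Z W))
  | W_left {i : Ty} (X Y Z : Str L At i) : UnaryRule (X ⊢ᴰ Z) (meet X Y ⊢ᴰ Z)
  | W_right {i : Ty} (X Y Z : Str L At i) : UnaryRule (X ⊢ᴰ Y) (X ⊢ᴰ join Y Z)
  | C_left {i : Ty} (X Z : Str L At i) : UnaryRule (meet X X ⊢ᴰ Z) (X ⊢ᴰ Z)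
  | C_right {i : Ty} (X Y : Str L At i) : UnaryRule (X ⊢ᴰ join Y Y) (X ⊢ᴰ Y)
  -- pure-type operational rules
  | one_left {i : Ty} (X : Str L At i) : UnaryRule (one ⊢ᴰ X) (fm .one ⊢ᴰ X)
  | zero_right {i : Ty} (X : Str L At i) : UnaryRule (X ⊢ᴰ zero) (X ⊢ᴰ fm .zero)
  | meet_left {i : Ty} (A B : Fm L At i) (X : Str L At i) :
      UnaryRule (meet (fm A) (fm B) ⊢ᴰ X) (fm (.meet A B) ⊢ᴰ X)
  | join_right {i : Ty} (A B : Fm L At i) (X : Str L At i) :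
      UnaryRule (X ⊢ᴰ join (fm A) (fm B)) (X ⊢ᴰ fm (.join A B))
  -- multi-type structural rules
  | P_zero (X : Str L At .one) : UnaryRule (zero ⊢ᴰ X) (P zero ⊢ᴰ X)
  | P_one (X : Str L At .one) : UnaryRule (X ⊢ᴰ one) (X ⊢ᴰ P one)
  -- multi-type operational rules
  | n_left (A : Fm L At .one) (X : Str L At .two) : UnaryRule (N (fm A) ⊢ᴰ X) (fm (.n A) ⊢ᴰ X)
  | n_right (A : Fm L At .one) (X : Str L At .two) : UnaryRule (X ⊢ᴰ N (fm A)) (X ⊢ᴰ fm (.n A))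
  | p_left (A : Fm L At .two) (X : Str L At .one) : UnaryRule (P (fm A) ⊢ᴰ X) (fm (.p A) ⊢ᴰ X)
  | p_right (A : Fm L At .two) (X : Str L At .one) : UnaryRule (X ⊢ᴰ P (fm A)) (X ⊢ᴰ fm (.p A))
  -- D.CBL only: multi-type structural rules for `∗ᵢ`
  | star_N_left (h : L = .CBL) (X : Str L At .one) (Y : Str L At .two) :
      UnaryRule (N (star h X) ⊢ᴰ Y) (star h (N X) ⊢ᴰ Y)
  | star_N_right (h : L = .CBL) (X : Str L At .two) (Y : Str L At .one) :
      UnaryRule (X ⊢ᴰ N (star h Y)) (X ⊢ᴰ star h (N Y))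
  -- D.CBL only: operational rules for `∼ᵢ`
  | neg_left {i : Ty} (h : L = .CBL) (A : Fm L At i) (Y : Str L At i) :
      UnaryRule (star h (fm A) ⊢ᴰ Y) (fm (.neg h A) ⊢ᴰ Y)
  | neg_right {i : Ty} (h : L = .CBL) (X : Str L At i) (A : Fm L At i) :
      UnaryRule (X ⊢ᴰ star h (fm A)) (X ⊢ᴰ fm (.neg h A))

open Str in
/-- The rules with two premises other than cut: `BinaryRule s₁ s₂ t` has conclusion `t`. -/
inductive BinaryRule {L : Logic} {At : Ty → Type*} :
    Sequent L At → Sequent L At → Sequent L At → Prop where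
  | meet_right {i : Ty} (A B : Fm L At i) (X Y : Str L At i) :
      BinaryRule (X ⊢ᴰ fm A) (Y ⊢ᴰ fm B) (meet X Y ⊢ᴰ fm (.meet A B))
  | join_left {i : Ty} (A B : Fm L At i) (X Y : Str L At i) :
      BinaryRule (fm A ⊢ᴰ X) (fm B ⊢ᴰ Y) (fm (.join A B) ⊢ᴰ join X Y)

/-- Derivations (proof trees) of D.BL, if `L = .BL`, and of D.CBL, if `L = .CBL`. -/
inductive Derivation {L : Logic} {At : Ty → Type*} : Sequent L At → Type _ where
  | zeroary {t : Sequent L At} (h : ZeroaryRule t) : Derivation t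
  | unary {s t : Sequent L At} (h : UnaryRule s t) (d : Derivation s) : Derivation t
  | binary {s₁ s₂ t : Sequent L At} (h : BinaryRule s₁ s₂ t)
      (d₁ : Derivation s₁) (d₂ : Derivation s₂) : Derivation t
  | cut {i : Ty} {X Y : Str L At i} (A : Fm L At i)
      (d₁ : Derivation (X ⊢ᴰ .fm A)) (d₂ : Derivation (.fm A ⊢ᴰ Y)) : Derivation (X ⊢ᴰ Y)

/-- The cut rule is not applied anywhere in the derivation. -/
def Derivation.CutFree {L : Logic} {At : Ty → Type*} :
    {t : Sequent L At} → Derivation t → Prop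
  | _, .zeroary _ => True
  | _, .unary _ d => d.CutFree
  | _, .binary _ d₁ d₂ => d₁.CutFree ∧ d₂.CutFree
  | _, .cut _ _ _ => False

/-- The set of all sequents that label a node of the derivation (its conclusion included). -/
def Derivation.sequents {L : Logic} {At : Ty → Type*} :
    {t : Sequent L At} → Derivation t → Set (Sequent L At)
  | t, .zeroary _ => {t}
  | t, .unary _ d => {t} ∪ d.sequents
  | t, .binary _ d₁ d₂ => {t} ∪ d₁.sequents ∪ d₂.sequents
  | _, .cut (X := X) (Y := Y) _ d₁ d₂ => {X ⊢ᴰ Y} ∪ d₁.sequents ∪ d₂.sequents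

/-- The set of subformulas of a formula (the formula itself included), of either type. -/
def Fm.subformulas {L : Logic} {At : Ty → Type*} :
    {i : Ty} → Fm L At i → Set (Σ j : Ty, Fm L At j)
  | _, .atom a => {⟨_, .atom a⟩}
  | i, .one => {⟨i, .one⟩}
  | i, .zero => {⟨i, .zero⟩}
  | _, .p A => {⟨_, .p A⟩} ∪ A.subformulas
  | _, .n A => {⟨_, .n A⟩} ∪ A.subformulas
  | _, .meet A B => {⟨_, .meet A B⟩} ∪ A.subformulas ∪ B.subformulas
  | _, .join A B => {⟨_, .join A B⟩} ∪ A.subformulas ∪ B.subformulas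
  | _, .neg h A => {⟨_, .neg h A⟩} ∪ A.subformulas

/-- The set of formulas, of either type, from which a structure is built by means of structural
operators. -/
def Str.formulas {L : Logic} {At : Ty → Type*} :
    {i : Ty} → Str L At i → Set (Σ j : Ty, Fm L At j)
  | _, .fm A => {⟨_, A⟩}
  | _, .one => ∅
  | _, .zero => ∅
  | _, .P X => X.formulas
  | _, .N X => X.formulas
  | _, .meet X Y => X.formulas ∪ Y.formulas
  | _, .join X Y => X.formulas ∪ Y.formulas
  | _, .imp X Y => X.formulas ∪ Y.formulas
  | _, .excl X Y => X.formulas ∪ Y.formulas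
  | _, .star _ X => X.formulas

/-- The set of formulas that occur in a sequent. -/
def Sequent.formulas {L : Logic} {At : Ty → Type*} (s : Sequent L At) :
    Set (Σ j : Ty, Fm L At j) :=
  s.ant.formulas ∪ s.suc.formulas

end BilatticeDisplay

/-!
Cut elimination follows Belnap's argument for display calculi. By induction on the cut formula `A`,
it suffices to derive `X ⊢ Y` without cut from cut-free derivations of `X ⊢ A` and `A ⊢ Y`.

*Parametric step.* Every structural operator is monotone or antitone in each argument, so each
occurrence of `A` in a sequent has a sign, and the rules relate only occurrences of equal sign.
Hence the occurrences of `A` that are ancestors of the cut formula of `X ⊢ A` can be replaced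
by `Y` throughout its derivation: every rule application remains one, except where `A` is
introduced. There `A` is the whole succedent, and what remains is to eliminate a cut of `A ⊢ Y`
with a sequent whose last rule introduces `A`. The same is done on the other side. The
relation `Replace` replaces any number of occurrences at once, so contraction causes no difficulty.
This step is `CutFreeDerivable.replace`, carried by `DoubleLine.exists_replace_top`,
`DoubleLine.exists_replace_bottom`, `UnaryRule.exists_replace`, `BinaryRule.exists_replace` and
`ZeroaryRule.replace`; `CutAdmissible.of_principal` applies it to both premises of a cut.

*Principal step.* If both premises introduce `A`, the display rules isolate the immediate
subformulas of `A`, and the cut becomes cuts on these (`cutAdmissible`). For `p`, `n` and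
`∼` the displayed cut yields `N X ⊢ N Y`, `P X ⊢ P Y` and `∗Y ⊢ ∗X`;
the invertible rules for `N`, `P` and `∗`,
read upwards, give `X ⊢ Y`.

The subformula property holds because no rule other than cut loses a formula on the way from its
premises to its conclusion, except into a principal formula of which it is a subformula
(`UnaryRule.formulas_subset`, `BinaryRule.formulas_subset`).
-/

namespace BilatticeDisplay

variable {L : Logic} {At : Ty → Type*}

/-! ### Cut-free derivability -/

/-- The sequent has a derivation in which cut is not applied. -/
def CutFreeDerivable (s : Sequent L At) : Prop :=
  ∃ d : Derivation s, d.CutFree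

namespace CutFreeDerivable

theorem zeroary {t : Sequent L At} (h : ZeroaryRule t) : CutFreeDerivable t :=
  ⟨.zeroary h, trivial⟩

theorem unary {s t : Sequent L At} (h : UnaryRule s t) : CutFreeDerivable s → CutFreeDerivable t
  | ⟨d, hd⟩ => ⟨.unary h d, hd⟩

theorem binary {s₁ s₂ t : Sequent L At} (h : BinaryRule s₁ s₂ t) :
    CutFreeDerivable s₁ → CutFreeDerivable s₂ → CutFreeDerivable t
  | ⟨d₁, h₁⟩, ⟨d₂, h₂⟩ => ⟨.binary h d₁ d₂, h₁, h₂⟩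

theorem down {s t : Sequent L At} (h : DoubleLine s t) : CutFreeDerivable s → CutFreeDerivable t :=
  unary (.down h)

theorem up {s t : Sequent L At} (h : DoubleLine s t) : CutFreeDerivable t → CutFreeDerivable s :=
  unary (.up h)

end CutFreeDerivable

/-! ### Replacing signed occurrences of a formula by a structure -/

/-- `Replace A Z b X X'`: the structure `X'` arises from `X` by replacing some (possibly none,
possibly all) of the positive occurrences of the formula `A` by the structure `Z`, where `X` itself
counts as a positive part if `b = true` and as a negative one if `b = false`. The sign flips in the
first argument of `imp`, in the second argument of `excl` and under `star`. -/
inductive Replace {j : Ty} (A : Fm L At j) (Z : Str L At j) :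
    Bool → {i : Ty} → Str L At i → Str L At i → Prop where
  | hole : Replace A Z true (.fm A) Z
  | fm {b : Bool} {i : Ty} (B : Fm L At i) : Replace A Z b (.fm B) (.fm B)
  | one {b : Bool} {i : Ty} : Replace A Z b (.one : Str L At i) .one
  | zero {b : Bool} {i : Ty} : Replace A Z b (.zero : Str L At i) .zero
  | P {b : Bool} {X X' : Str L At .two} : Replace A Z b X X' → Replace A Z b (.P X) (.P X')
  | N {b : Bool} {X X' : Str L At .one} : Replace A Z b X X' → Replace A Z b (.N X) (.N X')
  | meet {b : Bool} {i : Ty} {X X' Y Y' : Str L At i} :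
      Replace A Z b X X' → Replace A Z b Y Y' → Replace A Z b (.meet X Y) (.meet X' Y')
  | join {b : Bool} {i : Ty} {X X' Y Y' : Str L At i} :
      Replace A Z b X X' → Replace A Z b Y Y' → Replace A Z b (.join X Y) (.join X' Y')
  | imp {b : Bool} {i : Ty} {X X' Y Y' : Str L At i} :
      Replace A Z (!b) X X' → Replace A Z b Y Y' → Replace A Z b (.imp X Y) (.imp X' Y')
  | excl {b : Bool} {i : Ty} {X X' Y Y' : Str L At i} :
      Replace A Z b X X' → Replace A Z (!b) Y Y' → Replace A Z b (.excl X Y) (.excl X' Y')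
  | star {b : Bool} {i : Ty} {X X' : Str L At i} (h : L = .CBL) :
      Replace A Z (!b) X X' → Replace A Z b (.star h X) (.star h X')

/-- Replacement in a sequent: of occurrences of `A` in succedent position if `b = true`, and of
occurrences in antecedent position if `b = false`. -/
inductive Sequent.Replace {j : Ty} (A : Fm L At j) (Z : Str L At j) (b : Bool) :
    Sequent L At → Sequent L At → Prop where
  | mk {i : Ty} {X X' Y Y' : Str L At i} :
      BilatticeDisplay.Replace A Z (!b) X X' → BilatticeDisplay.Replace A Z b Y Y' →
        Replace A Z b (X ⊢ᴰ Y) (X' ⊢ᴰ Y')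

variable {j : Ty} {A : Fm L At j} {Z : Str L At j}

namespace Replace

theorem refl {b : Bool} {i : Ty} (X : Str L At i) : Replace A Z b X X := by
  induction X generalizing b with
  | fm B => exact .fm B
  | one => exact .one
  | zero => exact .zero
  | P X ih => exact .P ih
  | N X ih => exact .N ih
  | meet X Y ihX ihY => exact .meet ihX ihY
  | join X Y ihX ihY => exact .join ihX ihY
  | imp X Y ihX ihY => exact .imp ihX ihY
  | excl X Y ihX ihY => exact .excl ihX ihY
  | star h X ih => exact .star h ih

theorem exists_of_P {b : Bool} {X : Str L At .two} {W : Str L At .one}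
    (h : Replace A Z b (.P X) W) : ∃ X', W = .P X' ∧ Replace A Z b X X' := by
  cases h with | P h => exact ⟨_, rfl, h⟩

theorem exists_of_N {b : Bool} {X : Str L At .one} {W : Str L At .two}
    (h : Replace A Z b (.N X) W) : ∃ X', W = .N X' ∧ Replace A Z b X X' := by
  cases h with | N h => exact ⟨_, rfl, h⟩

theorem exists_of_meet {b : Bool} {i : Ty} {X Y W : Str L At i}
    (h : Replace A Z b (.meet X Y) W) :
    ∃ X' Y', W = .meet X' Y' ∧ Replace A Z b X X' ∧ Replace A Z b Y Y' := by
  cases h with | meet h₁ h₂ => exact ⟨_, _, rfl, h₁, h₂⟩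

theorem exists_of_join {b : Bool} {i : Ty} {X Y W : Str L At i}
    (h : Replace A Z b (.join X Y) W) :
    ∃ X' Y', W = .join X' Y' ∧ Replace A Z b X X' ∧ Replace A Z b Y Y' := by
  cases h with | join h₁ h₂ => exact ⟨_, _, rfl, h₁, h₂⟩

theorem exists_of_imp {b : Bool} {i : Ty} {X Y W : Str L At i}
    (h : Replace A Z b (.imp X Y) W) :
    ∃ X' Y', W = .imp X' Y' ∧ Replace A Z (!b) X X' ∧ Replace A Z b Y Y' := by
  cases h with | imp h₁ h₂ => exact ⟨_, _, rfl, h₁, h₂⟩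

theorem exists_of_excl {b : Bool} {i : Ty} {X Y W : Str L At i}
    (h : Replace A Z b (.excl X Y) W) :
    ∃ X' Y', W = .excl X' Y' ∧ Replace A Z b X X' ∧ Replace A Z (!b) Y Y' := by
  cases h with | excl h₁ h₂ => exact ⟨_, _, rfl, h₁, h₂⟩

theorem exists_of_star {b : Bool} {i : Ty} {h : L = .CBL} {X W : Str L At i}
    (hW : Replace A Z b (.star h X) W) : ∃ X', W = .star h X' ∧ Replace A Z (!b) X X' := by
  cases hW with | star _ hX => exact ⟨_, rfl, hX⟩

theorem eq_of_one {b : Bool} {i : Ty} {W : Str L At i}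
    (h : Replace A Z b .one W) : W = .one := by
  cases h; rfl

theorem eq_of_zero {b : Bool} {i : Ty} {W : Str L At i}
    (h : Replace A Z b .zero W) : W = .zero := by
  cases h; rfl

end Replace

/-- Replacement in the sequent below a double line can be matched by replacement in the sequent
above it, since the rule preserves the sign of every occurrence. -/
theorem DoubleLine.exists_replace_top {b : Bool} {s t t' : Sequent L At} (h : DoubleLine s t)
    (hr : t.Replace A Z b t') : ∃ s', s.Replace A Z b s' ∧ DoubleLine s' t' := by
  cases h with
  | res_left =>
    obtain ⟨hX, h₂⟩ := hr
    obtain ⟨_, _, rfl, hY, hZ⟩ := h₂.exists_of_imp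
    exact ⟨_, ⟨.meet hX hY, hZ⟩, .res_left ..⟩
  | res_right =>
    obtain ⟨h₁, hZ⟩ := hr
    obtain ⟨_, _, rfl, hX, hY⟩ := h₁.exists_of_excl
    -- For a concrete sign, `!!b` reduces to `b`; the cases below split on `b` for the same reason.
    cases b <;> exact ⟨_, ⟨hX, .join hY hZ⟩, .res_right ..⟩
  | adj_left =>
    obtain ⟨hX, h₂⟩ := hr
    obtain ⟨_, rfl, hY⟩ := h₂.exists_of_N
    exact ⟨_, ⟨.P hX, hY⟩, .adj_left ..⟩
  | adj_right =>
    obtain ⟨hX, h₂⟩ := hr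
    obtain ⟨_, rfl, hY⟩ := h₂.exists_of_P
    exact ⟨_, ⟨.N hX, hY⟩, .adj_right ..⟩
  | N =>
    obtain ⟨h₁, h₂⟩ := hr
    obtain ⟨_, rfl, hX⟩ := h₁.exists_of_N
    obtain ⟨_, rfl, hY⟩ := h₂.exists_of_N
    exact ⟨_, ⟨hX, hY⟩, .N ..⟩
  | P =>
    obtain ⟨h₁, h₂⟩ := hr
    obtain ⟨_, rfl, hX⟩ := h₁.exists_of_P
    obtain ⟨_, rfl, hY⟩ := h₂.exists_of_P
    exact ⟨_, ⟨hX, hY⟩, .P ..⟩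
  | adj_star_left =>
    obtain ⟨h₁, hX⟩ := hr
    obtain ⟨_, rfl, hY⟩ := h₁.exists_of_star
    cases b <;> exact ⟨_, ⟨.star _ hX, hY⟩, .adj_star_left ..⟩
  | adj_star_right =>
    obtain ⟨hY, h₂⟩ := hr
    obtain ⟨_, rfl, hX⟩ := h₂.exists_of_star
    cases b <;> exact ⟨_, ⟨hX, .star _ hY⟩, .adj_star_right ..⟩
  | cont =>
    obtain ⟨h₁, h₂⟩ := hr
    obtain ⟨_, rfl, hY⟩ := h₁.exists_of_star
    obtain ⟨_, rfl, hX⟩ := h₂.exists_of_star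
    cases b <;> exact ⟨_, ⟨hX, hY⟩, .cont ..⟩

/-- Replacement in the sequent above a double line can be matched by replacement in the sequent
below it. -/
theorem DoubleLine.exists_replace_bottom {b : Bool} {s t s' : Sequent L At} (h : DoubleLine s t)
    (hr : s.Replace A Z b s') : ∃ t', t.Replace A Z b t' ∧ DoubleLine s' t' := by
  cases h with
  | res_left =>
    obtain ⟨h₁, hZ⟩ := hr
    obtain ⟨_, _, rfl, hX, hY⟩ := h₁.exists_of_meet
    exact ⟨_, ⟨hX, .imp hY hZ⟩, .res_left ..⟩
  | res_right =>
    obtain ⟨hX, h₂⟩ := hr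
    obtain ⟨_, _, rfl, hY, hZ⟩ := h₂.exists_of_join
    cases b <;> exact ⟨_, ⟨.excl hX hY, hZ⟩, .res_right ..⟩
  | adj_left =>
    obtain ⟨h₁, hY⟩ := hr
    obtain ⟨_, rfl, hX⟩ := h₁.exists_of_P
    exact ⟨_, ⟨hX, .N hY⟩, .adj_left ..⟩
  | adj_right =>
    obtain ⟨h₁, hY⟩ := hr
    obtain ⟨_, rfl, hX⟩ := h₁.exists_of_N
    exact ⟨_, ⟨hX, .P hY⟩, .adj_right ..⟩
  | N =>
    obtain ⟨hX, hY⟩ := hr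
    exact ⟨_, ⟨.N hX, .N hY⟩, .N ..⟩
  | P =>
    obtain ⟨hX, hY⟩ := hr
    exact ⟨_, ⟨.P hX, .P hY⟩, .P ..⟩
  | adj_star_left =>
    obtain ⟨h₁, hY⟩ := hr
    obtain ⟨_, rfl, hX⟩ := h₁.exists_of_star
    cases b <;> exact ⟨_, ⟨.star _ hY, hX⟩, .adj_star_left ..⟩
  | adj_star_right =>
    obtain ⟨hX, h₂⟩ := hr
    obtain ⟨_, rfl, hY⟩ := h₂.exists_of_star
    cases b <;> exact ⟨_, ⟨hY, .star _ hX⟩, .adj_star_right ..⟩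
  | cont =>
    obtain ⟨hX, hY⟩ := hr
    cases b <;> exact ⟨_, ⟨.star _ hY, .star _ hX⟩, .cont ..⟩

/-! ### Principal formulas -/

/-- `X ⊢ A` is the conclusion of a rule that introduces `A` on the right (the identity axiom, for an
atom), with cut-free derivable premises. -/
def RightIntro : {i : Ty} → Fm L At i → Str L At i → Prop
  | _, .atom p, X => X = .fm (.atom p)
  | _, .one, X => X = .one
  | _, .zero, X => CutFreeDerivable (X ⊢ᴰ .zero)
  | _, .p A, X => CutFreeDerivable (X ⊢ᴰ .P (.fm A))
  | _, .n A, X => CutFreeDerivable (X ⊢ᴰ .N (.fm A))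
  | _, .meet A B, X => ∃ X₁ X₂, X = .meet X₁ X₂ ∧
      CutFreeDerivable (X₁ ⊢ᴰ .fm A) ∧ CutFreeDerivable (X₂ ⊢ᴰ .fm B)
  | _, .join A B, X => CutFreeDerivable (X ⊢ᴰ .join (.fm A) (.fm B))
  | _, .neg h A, X => CutFreeDerivable (X ⊢ᴰ .star h (.fm A))

/-- `A ⊢ Y` is the conclusion of a rule that introduces `A` on the left (the identity axiom, for an
atom), with cut-free derivable premises. -/
def LeftIntro : {i : Ty} → Fm L At i → Str L At i → Prop
  | _, .atom p, Y => Y = .fm (.atom p)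
  | _, .one, Y => CutFreeDerivable (.one ⊢ᴰ Y)
  | _, .zero, Y => Y = .zero
  | _, .p A, Y => CutFreeDerivable (.P (.fm A) ⊢ᴰ Y)
  | _, .n A, Y => CutFreeDerivable (.N (.fm A) ⊢ᴰ Y)
  | _, .meet A B, Y => CutFreeDerivable (.meet (.fm A) (.fm B) ⊢ᴰ Y)
  | _, .join A B, Y => ∃ Y₁ Y₂, Y = .join Y₁ Y₂ ∧
      CutFreeDerivable (.fm A ⊢ᴰ Y₁) ∧ CutFreeDerivable (.fm B ⊢ᴰ Y₂)
  | _, .neg h A, Y => CutFreeDerivable (.star h (.fm A) ⊢ᴰ Y)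

/-- `t` arises by replacing the displayed formula `A` by `Z` in the conclusion of a rule that
introduces `A`, on the right if `b = true` and on the left if `b = false`, from cut-free derivable
premises. If `Z` comes from the other premise of a cut on `A`, then `t` is the conclusion of a cut
in which `A` is principal in this premise. -/
inductive PrincipalInstance {j : Ty} (A : Fm L At j) (Z : Str L At j) : Bool → Sequent L At → Prop
  | right {X : Str L At j} : RightIntro A X → PrincipalInstance A Z true (X ⊢ᴰ Z)
  | left {Y : Str L At j} : LeftIntro A Y → PrincipalInstance A Z false (Z ⊢ᴰ Y)

/-- Replacement in the conclusion of a unary rule can be matched by replacement in its premise: the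
result is again an instance of the rule, unless the rule introduced the replaced formula. -/
theorem UnaryRule.exists_replace {b : Bool} {s t t' : Sequent L At} (h : UnaryRule s t)
    (hr : t.Replace A Z b t') : ∃ s', s.Replace A Z b s' ∧
      (UnaryRule s' t' ∨ (CutFreeDerivable s' → PrincipalInstance A Z b t')) := by
  cases h with
  | down h =>
    obtain ⟨s', hs, h⟩ := h.exists_replace_top hr
    exact ⟨s', hs, .inl (.down h)⟩
  | up h =>
    obtain ⟨s', hs, h⟩ := h.exists_replace_bottom hr
    exact ⟨s', hs, .inl (.up h)⟩
  | one_str =>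
    obtain ⟨hX, hY⟩ := hr
    exact ⟨_, ⟨.meet hX .one, hY⟩, .inl (.one_str ..)⟩
  | zero_str =>
    obtain ⟨hX, hY⟩ := hr
    exact ⟨_, ⟨hX, .join hY .zero⟩, .inl (.zero_str ..)⟩
  | E_left =>
    obtain ⟨h₁, hZ⟩ := hr
    obtain ⟨_, _, rfl, hY, hX⟩ := h₁.exists_of_meet
    exact ⟨_, ⟨.meet hX hY, hZ⟩, .inl (.E_left ..)⟩
  | E_right =>
    obtain ⟨hX, h₂⟩ := hr
    obtain ⟨_, _, rfl, hZ, hY⟩ := h₂.exists_of_join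
    exact ⟨_, ⟨hX, .join hY hZ⟩, .inl (.E_right ..)⟩
  | A_left =>
    obtain ⟨h₁, hW⟩ := hr
    obtain ⟨_, _, rfl, hX, h₃⟩ := h₁.exists_of_meet
    obtain ⟨_, _, rfl, hY, hZ⟩ := h₃.exists_of_meet
    exact ⟨_, ⟨.meet (.meet hX hY) hZ, hW⟩, .inl (.A_left ..)⟩
  | A_right =>
    obtain ⟨hX, h₂⟩ := hr
    obtain ⟨_, _, rfl, hY, h₃⟩ := h₂.exists_of_join
    obtain ⟨_, _, rfl, hZ, hW⟩ := h₃.exists_of_join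
    exact ⟨_, ⟨hX, .join (.join hY hZ) hW⟩, .inl (.A_right ..)⟩
  | W_left =>
    obtain ⟨h₁, hZ⟩ := hr
    obtain ⟨_, _, rfl, hX, hY⟩ := h₁.exists_of_meet
    exact ⟨_, ⟨hX, hZ⟩, .inl (.W_left ..)⟩
  | W_right =>
    obtain ⟨hX, h₂⟩ := hr
    obtain ⟨_, _, rfl, hY, hZ⟩ := h₂.exists_of_join
    exact ⟨_, ⟨hX, hY⟩, .inl (.W_right ..)⟩
  | C_left =>
    obtain ⟨hX, hZ⟩ := hr
    exact ⟨_, ⟨.meet hX hX, hZ⟩, .inl (.C_left ..)⟩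
  | C_right =>
    obtain ⟨hX, hY⟩ := hr
    exact ⟨_, ⟨hX, .join hY hY⟩, .inl (.C_right ..)⟩
  | P_zero =>
    obtain ⟨h₁, hX⟩ := hr
    obtain ⟨_, rfl, h₃⟩ := h₁.exists_of_P
    obtain rfl := h₃.eq_of_zero
    exact ⟨_, ⟨.zero, hX⟩, .inl (.P_zero ..)⟩
  | P_one =>
    obtain ⟨hX, h₂⟩ := hr
    obtain ⟨_, rfl, h₃⟩ := h₂.exists_of_P
    obtain rfl := h₃.eq_of_one
    exact ⟨_, ⟨hX, .one⟩, .inl (.P_one ..)⟩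
  | star_N_left =>
    obtain ⟨h₁, hY⟩ := hr
    obtain ⟨_, rfl, h₃⟩ := h₁.exists_of_star
    obtain ⟨_, rfl, hX⟩ := h₃.exists_of_N
    cases b <;> exact ⟨_, ⟨.N (.star _ hX), hY⟩, .inl (.star_N_left ..)⟩
  | star_N_right =>
    obtain ⟨hX, h₂⟩ := hr
    obtain ⟨_, rfl, h₃⟩ := h₂.exists_of_star
    obtain ⟨_, rfl, hY⟩ := h₃.exists_of_N
    cases b <;> exact ⟨_, ⟨hX, .N (.star _ hY)⟩, .inl (.star_N_right ..)⟩
  | one_left =>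
    obtain ⟨h, hX⟩ := hr
    cases b <;> cases h
    case false.hole => exact ⟨_, ⟨.one, hX⟩, .inr fun h => .left h⟩
    all_goals exact ⟨_, ⟨.one, hX⟩, .inl (.one_left ..)⟩
  | zero_right =>
    obtain ⟨hX, h⟩ := hr
    cases b <;> cases h
    case true.hole => exact ⟨_, ⟨hX, .zero⟩, .inr fun h => .right h⟩
    all_goals exact ⟨_, ⟨hX, .zero⟩, .inl (.zero_right ..)⟩
  | meet_left =>
    obtain ⟨h, hX⟩ := hr
    cases b <;> cases h
    case false.hole => exact ⟨_, ⟨.meet (.fm _) (.fm _), hX⟩, .inr fun h => .left h⟩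
    all_goals exact ⟨_, ⟨.meet (.fm _) (.fm _), hX⟩, .inl (.meet_left ..)⟩
  | join_right =>
    obtain ⟨hX, h⟩ := hr
    cases b <;> cases h
    case true.hole => exact ⟨_, ⟨hX, .join (.fm _) (.fm _)⟩, .inr fun h => .right h⟩
    all_goals exact ⟨_, ⟨hX, .join (.fm _) (.fm _)⟩, .inl (.join_right ..)⟩
  | n_left =>
    obtain ⟨h, hX⟩ := hr
    cases b <;> cases h
    case false.hole => exact ⟨_, ⟨.N (.fm _), hX⟩, .inr fun h => .left h⟩
    all_goals exact ⟨_, ⟨.N (.fm _), hX⟩, .inl (.n_left ..)⟩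
  | n_right =>
    obtain ⟨hX, h⟩ := hr
    cases b <;> cases h
    case true.hole => exact ⟨_, ⟨hX, .N (.fm _)⟩, .inr fun h => .right h⟩
    all_goals exact ⟨_, ⟨hX, .N (.fm _)⟩, .inl (.n_right ..)⟩
  | p_left =>
    obtain ⟨h, hX⟩ := hr
    cases b <;> cases h
    case false.hole => exact ⟨_, ⟨.P (.fm _), hX⟩, .inr fun h => .left h⟩
    all_goals exact ⟨_, ⟨.P (.fm _), hX⟩, .inl (.p_left ..)⟩
  | p_right =>
    obtain ⟨hX, h⟩ := hr
    cases b <;> cases h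
    case true.hole => exact ⟨_, ⟨hX, .P (.fm _)⟩, .inr fun h => .right h⟩
    all_goals exact ⟨_, ⟨hX, .P (.fm _)⟩, .inl (.p_right ..)⟩
  | neg_left =>
    obtain ⟨h, hX⟩ := hr
    cases b <;> cases h
    case false.hole => exact ⟨_, ⟨.star _ (.fm _), hX⟩, .inr fun h => .left h⟩
    all_goals exact ⟨_, ⟨.star _ (.fm _), hX⟩, .inl (.neg_left ..)⟩
  | neg_right =>
    obtain ⟨hX, h⟩ := hr
    cases b <;> cases h
    case true.hole => exact ⟨_, ⟨hX, .star _ (.fm _)⟩, .inr fun h => .right h⟩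
    all_goals exact ⟨_, ⟨hX, .star _ (.fm _)⟩, .inl (.neg_right ..)⟩

theorem ZeroaryRule.replace {b : Bool} {t t' : Sequent L At} (h : ZeroaryRule t)
    (hr : t.Replace A Z b t') : ZeroaryRule t' ∨ PrincipalInstance A Z b t' := by
  cases h with
  | id =>
    obtain ⟨h₁, h₂⟩ := hr
    cases b <;> cases h₁ <;> cases h₂
    case id.false.hole.fm => exact .inr (.left rfl)
    case id.true.fm.hole => exact .inr (.right rfl)
    all_goals exact .inl (.id _)
  | one_right =>
    obtain ⟨h₁, h₂⟩ := hr
    obtain rfl := h₁.eq_of_one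
    cases b <;> cases h₂
    case true.hole => exact .inr (.right rfl)
    all_goals exact .inl .one_right
  | zero_left =>
    obtain ⟨h₁, h₂⟩ := hr
    obtain rfl := h₂.eq_of_zero
    cases b <;> cases h₁
    case false.hole => exact .inr (.left rfl)
    all_goals exact .inl .zero_left

/-- The analogue of `UnaryRule.exists_replace` for rules with two premises. -/
theorem BinaryRule.exists_replace {b : Bool} {s₁ s₂ t t' : Sequent L At} (h : BinaryRule s₁ s₂ t)
    (hr : t.Replace A Z b t') : ∃ s₁' s₂', s₁.Replace A Z b s₁' ∧ s₂.Replace A Z b s₂' ∧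
      (BinaryRule s₁' s₂' t' ∨
        (CutFreeDerivable s₁' → CutFreeDerivable s₂' → PrincipalInstance A Z b t')) := by
  cases h with
  | meet_right =>
    obtain ⟨h, hC⟩ := hr
    obtain ⟨_, _, rfl, hX, hY⟩ := h.exists_of_meet
    cases b <;> cases hC
    case true.hole =>
      exact ⟨_, _, ⟨hX, .fm _⟩, ⟨hY, .fm _⟩, .inr fun h₁ h₂ => .right ⟨_, _, rfl, h₁, h₂⟩⟩
    all_goals exact ⟨_, _, ⟨hX, .fm _⟩, ⟨hY, .fm _⟩, .inl (.meet_right ..)⟩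
  | join_left =>
    obtain ⟨hC, h⟩ := hr
    obtain ⟨_, _, rfl, hX, hY⟩ := h.exists_of_join
    cases b <;> cases hC
    case false.hole =>
      exact ⟨_, _, ⟨.fm _, hX⟩, ⟨.fm _, hY⟩, .inr fun h₁ h₂ => .left ⟨_, _, rfl, h₁, h₂⟩⟩
    all_goals exact ⟨_, _, ⟨.fm _, hX⟩, ⟨.fm _, hY⟩, .inl (.join_left ..)⟩

/-! ### Cut elimination -/

/-- The parametric part of the argument: if the principal instances are cut-free derivable, then so
is every replacement instance of a cut-free derivable sequent. -/
theorem CutFreeDerivable.replace {b : Bool}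
    (H : ∀ t, PrincipalInstance A Z b t → CutFreeDerivable t) {s s' : Sequent L At}
    (hs : CutFreeDerivable s) (hr : s.Replace A Z b s') : CutFreeDerivable s' := by
  obtain ⟨d, hd⟩ := hs
  induction d generalizing s' with
  | zeroary h => exact (h.replace hr).elim .zeroary (H _)
  | unary h d ih =>
    obtain ⟨_, hp, h | h⟩ := h.exists_replace hr
    · exact .unary h (ih hp hd)
    · exact H _ (h (ih hp hd))
  | binary h d₁ d₂ ih₁ ih₂ =>
    obtain ⟨_, _, hp₁, hp₂, h | h⟩ := h.exists_replace hr
    · exact .binary h (ih₁ hp₁ hd.1) (ih₂ hp₂ hd.2)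
    · exact H _ (h (ih₁ hp₁ hd.1) (ih₂ hp₂ hd.2))
  | cut => exact hd.elim

/-- Cuts on `A` can be eliminated from derivations whose only cut is the last inference. -/
def CutAdmissible {i : Ty} (A : Fm L At i) : Prop :=
  ∀ ⦃X Y : Str L At i⦄, CutFreeDerivable (X ⊢ᴰ .fm A) → CutFreeDerivable (.fm A ⊢ᴰ Y) →
    CutFreeDerivable (X ⊢ᴰ Y)

/-- It suffices to eliminate the cuts whose cut formula is principal in both premises. -/
theorem CutAdmissible.of_principal {i : Ty} {A : Fm L At i}
    (H : ∀ X Y, RightIntro A X → LeftIntro A Y → CutFreeDerivable (X ⊢ᴰ Y)) :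
    CutAdmissible A := by
  intro X Y hX hY
  -- Permute the cut up on the left, replacing succedent occurrences of `A` by `Y`, until `A` is
  -- principal there.
  refine hX.replace (A := A) (Z := Y) (b := true) ?_ ⟨.refl _, .hole⟩
  rintro _ ⟨hX'⟩
  -- Then permute it up on the right, replacing antecedent occurrences of `A` by the antecedent of
  -- the principal left premise.
  refine hY.replace (A := A) (b := false) ?_ ⟨.hole, .refl _⟩
  rintro _ (_ | hY')
  exact H _ _ hX' hY'

/-- Every cut is eliminable: a cut that is principal on both sides is replaced, after displaying the
immediate subformulas of the cut formula, by cuts on these. -/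
theorem cutAdmissible {i : Ty} (A : Fm L At i) : CutAdmissible A := by
  induction A with
  | atom p =>
    refine .of_principal ?_
    rintro _ _ rfl rfl
    exact .zeroary (.id p)
  | one =>
    refine .of_principal ?_
    rintro _ Y rfl hY
    exact hY
  | zero =>
    refine .of_principal ?_
    rintro X _ hX rfl
    exact hX
  | p A ih =>
    refine .of_principal fun X Y hX hY => ?_
    exact (ih (hX.up (.adj_right ..)) (hY.down (.adj_left ..))).up (.N ..)
  | n A ih =>
    refine .of_principal fun X Y hX hY => ?_
    exact (ih (hX.up (.adj_left ..)) (hY.down (.adj_right ..))).up (.P ..)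
  | meet A B ihA ihB =>
    refine .of_principal ?_
    rintro _ Y ⟨X₁, X₂, rfl, h₁, h₂⟩ hY
    -- Cut on `A` gives `X₁ ⊓̂ B ⊢ Y`; exchange displays `B`, and cut on `B` gives `X₂ ⊓̂ X₁ ⊢ Y`.
    have hB := (ihA h₁ (hY.down (.res_left ..))).up (.res_left ..)
    have hX := ihB h₂ ((hB.unary (.E_left ..)).down (.res_left ..))
    exact (hX.up (.res_left ..)).unary (.E_left ..)
  | join A B ihA ihB =>
    refine .of_principal ?_
    rintro X _ hX ⟨Y₁, Y₂, rfl, h₁, h₂⟩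
    -- Cut on `B` gives `X ⊢ A ⊔̌ Y₂`; exchange displays `A`, and cut on `A` gives `X ⊢ Y₂ ⊔̌ Y₁`.
    have hA := (ihB (hX.down (.res_right ..)) h₂).up (.res_right ..)
    have hY := ihA ((hA.unary (.E_right ..)).down (.res_right ..)) h₁
    exact (hY.up (.res_right ..)).unary (.E_right ..)
  | neg h A ih =>
    -- Displaying `A` swaps the two sides: the cut is of `∗Y ⊢ A` with `A ⊢ ∗X`.
    refine .of_principal fun X Y hX hY => ?_
    exact (ih (hY.down (.adj_star_left ..)) (hX.down (.adj_star_right ..))).up (.cont h ..)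

theorem Derivation.cutFreeDerivable {s : Sequent L At} (d : Derivation s) :
    CutFreeDerivable s := by
  induction d with
  | zeroary h => exact .zeroary h
  | unary h _ ih => exact ih.unary h
  | binary h _ _ ih₁ ih₂ => exact ih₁.binary h ih₂
  | cut A _ _ ih₁ ih₂ => exact cutAdmissible A ih₁ ih₂

/-! ### The subformula property -/

theorem Fm.mem_subformulas_self {i : Ty} (A : Fm L At i) : ⟨i, A⟩ ∈ A.subformulas := by
  cases A <;> simp [subformulas]

theorem Fm.subformulas_trans {i : Ty} {A : Fm L At i} {B C : Σ k : Ty, Fm L At k}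
    (hB : B ∈ A.subformulas) (hC : C ∈ B.2.subformulas) : C ∈ A.subformulas := by
  induction A <;> simp only [subformulas, Set.mem_union, Set.mem_singleton_iff] at hB ⊢ <;>
    grind [subformulas]

/-- The subformulas of the formulas that occur in a sequent. -/
def Sequent.subformulas (s : Sequent L At) : Set (Σ k : Ty, Fm L At k) :=
  {A | ∃ B ∈ s.formulas, A ∈ B.2.subformulas}

theorem Sequent.formulas_subset_subformulas (s : Sequent L At) : s.formulas ⊆ s.subformulas :=
  fun B hB => ⟨B, hB, B.2.mem_subformulas_self⟩

theorem Sequent.subformulas_subset_of_formulas_subset {s t : Sequent L At}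
    (h : s.formulas ⊆ t.subformulas) : s.subformulas ⊆ t.subformulas := by
  rintro C ⟨B, hB, hC⟩
  obtain ⟨A, hA, hBA⟩ := h hB
  exact ⟨A, hA, Fm.subformulas_trans hBA hC⟩

/-- Double line rules only rearrange formulas, so that they lose none in either direction. -/
theorem DoubleLine.formulas_eq {s t : Sequent L At} (h : DoubleLine s t) :
    s.formulas = t.formulas := by
  cases h <;> simp only [Sequent.formulas, Str.formulas] <;> grind

/-- No rule other than cut loses a formula: each formula of the premise is a formula of the
conclusion or, in an operational rule, an immediate subformula of the principal formula. -/
theorem UnaryRule.formulas_subset {s t : Sequent L At} (h : UnaryRule s t) :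
    s.formulas ⊆ t.subformulas := by
  cases h with
  | down h => exact h.formulas_eq.subset.trans t.formulas_subset_subformulas
  | up h => exact h.formulas_eq.symm.subset.trans t.formulas_subset_subformulas
  | _ =>
    rintro ⟨k, C⟩ hC
    have := Fm.mem_subformulas_self C
    simp only [Sequent.formulas, Str.formulas, Set.mem_union, Set.mem_singleton_iff,
      Set.mem_empty_iff_false] at hC
    simp only [Sequent.subformulas, Sequent.formulas, Str.formulas, Set.mem_ofPred_eq,
      Set.mem_union, Set.mem_singleton_iff]
    grind [Fm.subformulas, Fm.mem_subformulas_self]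

theorem BinaryRule.formulas_subset {s₁ s₂ t : Sequent L At} (h : BinaryRule s₁ s₂ t) :
    s₁.formulas ∪ s₂.formulas ⊆ t.subformulas := by
  cases h with
  | _ =>
    rintro ⟨k, C⟩ hC
    have := Fm.mem_subformulas_self C
    simp only [Sequent.formulas, Str.formulas, Set.mem_union, Set.mem_singleton_iff] at hC
    simp only [Sequent.subformulas, Sequent.formulas, Str.formulas, Set.mem_ofPred_eq,
      Set.mem_union, Set.mem_singleton_iff]
    grind [Fm.subformulas, Fm.mem_subformulas_self]

theorem Derivation.CutFree.formulas_subset {s t : Sequent L At} {d : Derivation s}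
    (hd : d.CutFree) (ht : t ∈ d.sequents) : t.formulas ⊆ s.subformulas := by
  induction d with
  | @zeroary s =>
    obtain rfl : t = s := ht
    exact t.formulas_subset_subformulas
  | @unary _ s h d ih =>
    obtain (rfl : t = s) | ht := ht
    · exact t.formulas_subset_subformulas
    · exact (ih hd ht).trans (Sequent.subformulas_subset_of_formulas_subset h.formulas_subset)
  | @binary _ _ s h d₁ d₂ ih₁ ih₂ =>
    obtain ((rfl : t = s) | ht) | ht := ht
    · exact t.formulas_subset_subformulas
    · exact (ih₁ hd.1 ht).trans (Sequent.subformulas_subset_of_formulas_subset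
        (Set.subset_union_left.trans h.formulas_subset))
    · exact (ih₂ hd.2 ht).trans (Sequent.subformulas_subset_of_formulas_subset
        (Set.subset_union_right.trans h.formulas_subset))
  | cut => exact hd.elim

end BilatticeDisplay

/-- Cut elimination and the subformula property, for both D.BL (`L = .BL`) and D.CBL
(`L = .CBL`). -/
theorem mainTheorem1 (L : BilatticeDisplay.Logic) (At : BilatticeDisplay.Ty → Type*) :
    -- cut elimination
    (∀ s : BilatticeDisplay.Sequent L At, Nonempty (BilatticeDisplay.Derivation s) →
      ∃ d : BilatticeDisplay.Derivation s, d.CutFree) ∧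
    -- subformula property
    (∀ (s : BilatticeDisplay.Sequent L At) (d : BilatticeDisplay.Derivation s), d.CutFree →
      ∀ t ∈ d.sequents, ∀ A ∈ t.formulas, ∃ B ∈ s.formulas, A ∈ B.2.subformulas) :=
  ⟨fun _ ⟨d⟩ => d.cutFreeDerivable, fun _ _ hd _ ht _ hA => hd.formulas_subset ht hA⟩
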